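/- Let $\mathcal X$ be a complex Banach space with $\dim\mathcal X\ge 3$, let $\mathcal B(\mathcal X)$ be the algebra of bounded linear operators on $\mathcal X$, and let $\mathcal N_1(\mathcal X)\subseteq\mathcal B(\mathcal X)$ be the set of all nilpotent operators of rank one. For operators $T,S$ write $T\sim S$ if $T$ and $S$ have the same range or the same kernel. Let $\mathcal X^\ast$ be the space of bounded linear functionals on $\mathcal X$ and, for $T\in\mathcal B(\mathcal X)$, let $T'$ be the adjoint operator on $\mathcal X^\ast$, $T'h=h\circ T$. Write $\mathbb C^\ast=\mathbb C\setminus\{0\}$. Let $\psi:\mathcal N_1(\mathcal X)\cup\{0\}\to\mathcal N_1(\mathcal X)\cup\{0\}$ be a surjective map such that * $\psi(0)=0$; * for all $T,S\in\mathcal N_1(\mathcal X)\cup\{0\}$, the pair $T,S$ is linearly dependent if and only if the pair $\psi(T),\psi(S)$ is linearly dependent; * for all $T,S\in\mathcal N_1(\mathcal X)$, $T\sim S$ if and only if $\psi(T)\sim\psi(S)$. (1) If $\mathcal X$ is infinite-dimensional, then there is a map $\lambda:\mathcal N_1(\mathcal X)\to\mathbb C^\ast$ such that at least one of the following holds: *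 there is a bounded linear or bounded conjugate-linear bijection $A:\mathcal X\to\mathcal X$ with bounded inverse such that $\psi(T)=\lambda(T)\,ATA^{-1}$ for all $T\in\mathcal N_1(\mathcal X)$; * there is a bounded linear or bounded conjugate-linear bijection $A:\mathcal X^\ast\to\mathcal X$ with bounded inverse such that $\psi(T)=\lambda(T)\,AT'A^{-1}$ for all $T\in\mathcal N_1(\mathcal X)$. (2) If $\mathcal X$ has finite dimension $n\,(\ge 3)$ and operators on $\mathcal X$ are identified with $n\times n$ complex matrices by means of an arbitrary fixed basis of $\mathcal X$, then there are a nonsingular matrix $A\in M_n(\mathbb C)$, a field automorphism $\tau$ of $\mathbb C$ and a map $\lambda:\mathcal N_1(\mathcal X)\to\mathbb C^\ast$ such that either $$\psi(T)=\lambda(T)\,A\,[\tau(t_{ij})]\,A^{-1}\quad\text{for all } T=[t_{ij}]\in\mathcal N_1(\mathcal X),$$ or $$\psi(T)=\lambda(T)\,A\,[\tau(t_{ij})]^{\mathrm{tr}}A^{-1}\quad\text{for all } T=[t_{ij}]\in\mathcal N_1(\mathcal X),$$ where $^{\mathrm{tr}}$ denotes transposition. -/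

import Mathlib

/-- The set of all rank-one nilpotent bounded operators on `X`. -/
def rankOneNilpotents (X : Type*) [NormedAddCommGroup X] [NormedSpace ℂ X] :
    Set (X →L[ℂ] X) :=
  {T | LinearMap.rank (T : X →ₗ[ℂ] X) = 1 ∧ IsNilpotent T}

/-- The set of all rank-one nilpotent bounded operators on `X`, together with the zero operator. -/
def rankOneNilpotentsWithZero (X : Type*) [NormedAddCommGroup X] [NormedSpace ℂ X] :
    Set (X →L[ℂ] X) :=
  rankOneNilpotents X ∪ {0}

/-- Two operators are linearly dependent: some nontrivial linear combination of them is zero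
(the two operators are counted as a pair, so `T, T` are linearly dependent). -/
def LinDepPair {X : Type*} [NormedAddCommGroup X] [NormedSpace ℂ X] (T S : X →L[ℂ] X) : Prop :=
  ¬ LinearIndependent ℂ ![T, S]

/-- The relation `T ∼ S`: the operators have the same range or the same kernel. -/
def SameRangeOrKer {X : Type*} [NormedAddCommGroup X] [NormedSpace ℂ X]
    (T S : X →L[ℂ] X) : Prop :=
  LinearMap.range (T : X →ₗ[ℂ] X) = LinearMap.range (S : X →ₗ[ℂ] X) ∨
    LinearMap.ker (T : X →ₗ[ℂ] X) = LinearMap.ker (S : X →ₗ[ℂ] X)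

/-- The (Banach space) adjoint `T'` of `T`, acting on the dual space by `T' h = h ∘ T`. -/
noncomputable def dualOperator {X : Type*} [NormedAddCommGroup X] [NormedSpace ℂ X]
    (T : X →L[ℂ] X) : StrongDual ℂ X →L[ℂ] StrongDual ℂ X :=
  ContinuousLinearMap.precomp ℂ T

/-! Up to a scalar, a rank-one nilpotent `f.smulRight x` with `f x = 0` is a flag: a point (its
range) on a hyperplane (its kernel). Linear dependence means equality of flags, and `∼` means that
the flags share the point or the hyperplane. A map respecting both relations must preserve the two
coordinates or interchange them (`coordinate_relations_preserved_or_swapped`). It therefore acts on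
points and hyperplanes compatibly with incidence, as a collineation of `X` or as a correlation from
the dual to `X`. The fundamental theorem of projective geometry then yields a `τ`-semilinear
bijection `A` (`exists_semilinear_of_incidence`).

`A` also carries each functional `f` to a bounded functional `g` with `g (A x) = τ (f x)` (with
vectors and functionals interchanged in the dual case). In infinite dimension a gliding-hump
argument along a biorthogonal sequence turns this into continuity of `τ`
(`continuous_of_norm_apply_le`). So `τ` is the identity or conjugation, and the closed graph theorem
bounds `A`. In finite dimension `τ` stays arbitrary and `A` is written as a matrix. -/

/-! ### Additivity and semilinearity from proportionality of differences. -/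

section SemilinearMaps

variable {K H V : Type*} [Field K] [AddCommGroup H] [Module K H] [AddCommGroup V] [Module K V]

/-- A map sending differences to proportional differences and independent pairs to independent
pairs is additive. -/
theorem map_add_of_sub_proportional (hrank : 1 < Module.rank K H) {A : H → V} (hA0 : A 0 = 0)
    (hsub : ∀ h k, ∃ c : K, A h - A k = c • A (h - k))
    (hind : ∀ h k, LinearIndependent K ![h, k] → LinearIndependent K ![A h, A k]) (h k : H) :
    A (h + k) = A h + A k := by
  have key : ∀ h k, LinearIndependent K ![h, k] → A (h + k) = A h + A k := by
    intro h k hhk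
    obtain ⟨a, ha⟩ := hsub (h + k) h
    obtain ⟨b, hb⟩ := hsub (h + k) k
    rw [add_sub_cancel_left] at ha
    rw [add_sub_cancel_right] at hb
    -- Comparing the two expressions for `A (h + k)` gives this vanishing combination of `A h` and
    -- `A k`.
    have h1 := LinearIndependent.pair_iff.1 (hind h k hhk) (1 - b) (a - 1) (by
      rw [sub_smul, sub_smul, ← ha, ← hb]
      simp only [one_smul]
      abel)
    have ha1 : a = 1 := sub_eq_zero.1 h1.2
    rw [ha1, one_smul] at ha
    rw [← ha]
    abel
  rcases eq_or_ne h 0 with rfl | hh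
  · simp [hA0]
  by_cases hhk : LinearIndependent K ![h, k]
  · exact key h k hhk
  rw [LinearIndependent.pair_iff' hh] at hhk
  push Not at hhk
  obtain ⟨m, rfl⟩ := hhk
  -- On a single line, a vector `z` off it allows `A ((1 + m) • h + z)` to be computed in two ways
  -- from independent pairs.
  obtain ⟨z, hz⟩ := exists_linearIndependent_pair_of_one_lt_rank hrank hh
  have hmul : ∀ c : K, A (c • h + z) = A (c • h) + A z := by
    intro c
    rcases eq_or_ne c 0 with rfl | hc
    · simp [hA0]
    · refine key _ _ ?_
      rw [LinearIndependent.pair_iff] at hz ⊢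
      intro s t hst
      rw [smul_smul] at hst
      have := hz _ _ hst
      exact ⟨by simpa [hc] using this.1, this.2⟩
  have h1 := hmul (1 + m)
  have h2 : A (h + (m • h + z)) = A h + A (m • h + z) := by
    refine key _ _ ?_
    rw [LinearIndependent.pair_iff] at hz ⊢
    intro s t hst
    have := hz (s + t * m) t (by rw [← hst, add_smul, mul_smul, smul_add]; abel)
    obtain ⟨h3, h4⟩ := this
    subst h4
    simpa using h3
  rw [add_smul, one_smul, add_assoc, h2, hmul m, ← add_assoc] at h1
  exact (add_right_cancel h1).symm

/-- A map sending differences to proportional differences, lines onto lines and independent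
pairs to independent pairs is semilinear. -/
theorem exists_ringEquiv_of_sub_proportional (hrank : 1 < Module.rank K H) {A : H → V}
    (hA0 : A 0 = 0) (hsub : ∀ h k, ∃ c : K, A h - A k = c • A (h - k))
    (hind : ∀ h k, LinearIndependent K ![h, k] → LinearIndependent K ![A h, A k])
    (hsmul : ∀ (c : K) h, ∃ d : K, A (c • h) = d • A h)
    (hsmul' : ∀ (d : K) h, ∃ c : K, A (c • h) = d • A h) :
    ∃ τ : K ≃+* K, ∀ (c : K) h, A (c • h) = τ c • A h := by
  have hadd := map_add_of_sub_proportional hrank hA0 hsub hind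
  have hne : ∀ h, h ≠ 0 → A h ≠ 0 := by
    intro h hh
    obtain ⟨z, hz⟩ := exists_linearIndependent_pair_of_one_lt_rank hrank hh
    simpa using (hind h z hz).ne_zero 0
  obtain ⟨h0, hh0⟩ : ∃ h : H, h ≠ 0 := by
    have : Nontrivial H := rank_pos_iff_nontrivial.1 (lt_trans zero_lt_one hrank)
    exact exists_ne 0
  choose t ht using hsmul
  have tind : ∀ h k, LinearIndependent K ![h, k] → ∀ c, t c h = t c k := by
    intro h k hhk c
    have h1 := ht c (h + k)
    rw [smul_add, hadd, hadd, ht c h, ht c k] at h1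
    have := LinearIndependent.pair_iff.1 (hind h k hhk) (t c h - t c (h + k))
      (t c k - t c (h + k)) (by
        rw [sub_smul, sub_smul, sub_add_sub_comm, h1, smul_add, sub_self])
    rw [sub_eq_zero.1 this.1, sub_eq_zero.1 this.2]
  have tconst : ∀ c h, h ≠ 0 → t c h = t c h0 := by
    intro c h hh
    by_cases hi : LinearIndependent K ![h0, h]
    · exact (tind _ _ hi c).symm
    · rw [LinearIndependent.pair_iff' hh0] at hi
      push Not at hi
      obtain ⟨m, rfl⟩ := hi
      have hm : m ≠ 0 := fun h => hh (by simp [h])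
      obtain ⟨z, hz⟩ := exists_linearIndependent_pair_of_one_lt_rank hrank hh0
      rw [tind _ _ hz c]
      refine tind _ _ ?_ c
      rw [LinearIndependent.pair_iff] at hz ⊢
      intro s u hst
      rw [smul_smul] at hst
      have := hz _ _ hst
      exact ⟨by simpa [hm] using this.1, this.2⟩
  have hτ : ∀ c h, A (c • h) = t c h0 • A h := by
    intro c h
    rcases eq_or_ne h 0 with rfl | hh
    · simp [hA0]
    · rw [← tconst c h hh, ht]
  have hinj : ∀ {c d : K}, c • A h0 = d • A h0 → c = d := fun h =>
    smul_left_injective K (hne h0 hh0) h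
  let f : K →+* K :=
    { toFun := fun c => t c h0
      map_one' := hinj (by rw [← hτ, one_smul, one_smul])
      map_mul' := fun c d => hinj (by rw [← hτ, mul_smul, hτ, hτ, mul_smul])
      map_zero' := hinj (by rw [← hτ, zero_smul, zero_smul, hA0])
      map_add' := fun c d => hinj (by rw [← hτ, add_smul, hadd, hτ, hτ, add_smul]) }
  have hbij : Function.Bijective f := by
    refine ⟨f.injective, fun d => ?_⟩
    obtain ⟨c, hc⟩ := hsmul' d h0
    exact ⟨c, hinj (by rw [← hc, hτ]; rfl)⟩
  exact ⟨RingEquiv.ofBijective f hbij, hτ⟩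

end SemilinearMaps

/-! ### The fundamental theorem of projective geometry, and its version for incidence. -/

section ProjectiveGeometry

variable {K V V' : Type*} [Field K] [AddCommGroup V] [Module K V] [AddCommGroup V'] [Module K V']

theorem one_lt_rank_ker (hrank : 3 ≤ Module.rank K V) (f : V →ₗ[K] K) :
    1 < Module.rank K (LinearMap.ker f) := by
  have h1 := LinearMap.lift_rank_range_add_rank_ker f
  by_contra! h
  have h2 : Module.rank K (LinearMap.range f) ≤ 1 := by
    simpa using Submodule.rank_le (LinearMap.range f)
  have h3 : Module.rank K V ≤ 2 := by
    rw [← Cardinal.lift_le.{_, _}, ← h1]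
    calc _ ≤ (1 : Cardinal) + 1 := by
            gcongr
            · simpa using h2
            · simpa using h
      _ = _ := by norm_num
  have := hrank.trans h3
  norm_num at this

theorem map_smul_of_span_iff {p : V → V'}
    (hspan : ∀ u v w, u ≠ 0 → v ≠ 0 → w ≠ 0 →
      (u ∈ Submodule.span K {v, w} ↔ p u ∈ Submodule.span K {p v, p w}))
    {u v : V} (hu : u ≠ 0) (hv : v ≠ 0) :
    (∃ c : K, u = c • v) ↔ ∃ c : K, p u = c • p v := by
  have := hspan u v v hu hv hv
  simp only [Set.pair_eq_singleton, Submodule.mem_span_singleton] at this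
  simpa only [eq_comm] using this

/-- The fundamental theorem of projective geometry, for collineations mapping a given hyperplane
to a hyperplane. -/
theorem exists_semilinear_of_span_iff (hrank : 3 ≤ Module.rank K V) {p : V → V'}
    (hp0 : ∀ v, v ≠ 0 → p v ≠ 0)
    (hspan : ∀ u v w, u ≠ 0 → v ≠ 0 → w ≠ 0 →
      (u ∈ Submodule.span K {v, w} ↔ p u ∈ Submodule.span K {p v, p w}))
    (hsurj : ∀ y, y ≠ 0 → ∃ v, v ≠ 0 ∧ ∃ c : K, p v = c • y)
    {f : V →ₗ[K] K} {f' : V' →ₗ[K] K} (hf0 : f ≠ 0)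
    (hf : ∀ v, v ≠ 0 → (f' (p v) = 0 ↔ f v = 0)) :
    ∃ (τ : K ≃+* K) (A : V ≃+ V'), (∀ (c : K) v, A (c • v) = τ c • A v) ∧
      ∀ v, v ≠ 0 → ∃ c : K, p v = c • A v := by
  have hne : ∀ {v}, f v = 1 → v ≠ 0 := by
    rintro v hv rfl
    simp at hv
  obtain ⟨a, ha⟩ : ∃ a, f a = 1 := by
    obtain ⟨v, hv⟩ := DFunLike.ne_iff.1 hf0
    exact ⟨(f v)⁻¹ • v, by simpa using inv_mul_cancel₀ hv⟩
  have hprop := fun {u v : V} hu hv => map_smul_of_span_iff (u := u) (v := v) hspan hu hv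
  -- normalised representatives on the affine hyperplane `f = 1`
  let P : V → V' := fun v => (f' (p v))⁻¹ • p v
  have hfp : ∀ {v}, f v = 1 → f' (p v) ≠ 0 := fun {v} hv h => by
    have := (hf v (hne hv)).1 h
    rw [hv] at this
    exact one_ne_zero this
  have hP1 : ∀ {v}, f v = 1 → f' (P v) = 1 := fun {v} hv => by
    simpa [P] using inv_mul_cancel₀ (hfp hv)
  have hPp : ∀ {v}, f v = 1 → p v = f' (p v) • P v := fun {v} hv => by
    simp [P, smul_smul, mul_inv_cancel₀ (hfp hv)]
  have hPeq : ∀ {v y} {c : K}, f v = 1 → f' y = 1 → p v = c • y → P v = y := by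
    intro v y c hv hy h
    have : f' (p v) = c := by rw [h, map_smul, hy, smul_eq_mul, mul_one]
    have hc : c ≠ 0 := this ▸ hfp hv
    simp only [P]
    rw [this, h, smul_smul, inv_mul_cancel₀ hc, one_smul]
  -- The vector `u - v` is the point at infinity of the line through `u` and `v`. Its image lies on
  -- the line through `P u` and `P v` and in `ker f'`, which forces opposite coefficients.
  have hPsub : ∀ {u v}, f u = 1 → f v = 1 → u ≠ v →
      ∃ c : K, c ≠ 0 ∧ p (u - v) = c • (P u - P v) := by
    intro u v hu hv huv
    have huv' := sub_ne_zero.2 huv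
    have h1 := (hspan (u - v) u v huv' (hne hu) (hne hv)).1
      (Submodule.mem_span_pair.2 ⟨1, -1, by simp [sub_eq_add_neg]⟩)
    obtain ⟨α, β, h2⟩ := Submodule.mem_span_pair.1 h1
    obtain ⟨α', hα'⟩ : ∃ α', α' = α * f' (p u) := ⟨_, rfl⟩
    obtain ⟨β', hβ'⟩ : ∃ β', β' = β * f' (p v) := ⟨_, rfl⟩
    replace h2 : α' • P u + β' • P v = p (u - v) := by
      rw [hα', hβ', mul_smul, mul_smul, ← hPp hu, ← hPp hv, h2]
    have h3 : f' (p (u - v)) = 0 := (hf _ huv').2 (by rw [map_sub, hu, hv, sub_self])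
    rw [← h2, map_add, map_smul f' α' (P u), map_smul f' β' (P v), hP1 hu, hP1 hv, smul_eq_mul,
      smul_eq_mul, mul_one, mul_one] at h3
    have h4 : β' = -α' := by linear_combination h3
    have h5 : p (u - v) = α' • (P u - P v) := by
      rw [← h2, h4, smul_sub, neg_smul, sub_eq_add_neg]
    refine ⟨α', fun h => hp0 _ huv' ?_, h5⟩
    rw [h5, h, zero_smul]
  have hPsurj : ∀ y, f' y = 1 → ∃ v, f v = 1 ∧ P v = y := by
    intro y hy
    obtain ⟨v, hv, c, hc⟩ := hsurj y (by rintro rfl; simp at hy)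
    have hfv : f v ≠ 0 := by
      intro h
      have := (hf v hv).2 h
      rw [hc, map_smul, hy, smul_eq_mul, mul_one] at this
      exact hp0 v hv (by rw [hc, this, zero_smul])
    have h1 : f ((f v)⁻¹ • v) = 1 := by simpa using inv_mul_cancel₀ hfv
    refine ⟨_, h1, ?_⟩
    obtain ⟨d, hd⟩ := (hprop (hne h1) hv).1 ⟨_, rfl⟩
    rw [hc, smul_smul] at hd
    exact hPeq h1 hy hd
  -- the induced map on the direction space
  have hfa : ∀ h : LinearMap.ker f, f (a + h) = 1 := fun h => by
    rw [map_add, ha, LinearMap.mem_ker.1 h.2, add_zero]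
  let A : LinearMap.ker f → V' := fun h => P (a + h) - P a
  have hA0 : A 0 = 0 := by simp [A]
  have hAp : ∀ h : LinearMap.ker f, h ≠ 0 → ∃ c : K, c ≠ 0 ∧ p h = c • A h := by
    intro h hh
    have := hPsub (hfa h) ha (by simpa using hh)
    simpa [A] using this
  have hAprop : ∀ h k : LinearMap.ker f, h ≠ 0 → k ≠ 0 →
      ((∃ c : K, A h = c • A k) ↔ ∃ c : K, h = c • k) := by
    intro h k hh hk
    obtain ⟨c, hc, h1⟩ := hAp h hh
    obtain ⟨d, hd, h2⟩ := hAp k hk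
    have h3 := hprop (u := (h : V)) (v := k) (by simpa using hh) (by simpa using hk)
    have h4 : (∃ c : K, h = c • k) ↔ ∃ c : K, (h : V) = c • (k : V) := by
      simp [Subtype.ext_iff]
    rw [h4, h3, h1, h2]
    constructor
    · rintro ⟨e, he⟩
      exact ⟨c * e * d⁻¹, by rw [he]; simp only [smul_smul]; congr 1; field_simp⟩
    · rintro ⟨e, he⟩
      refine ⟨c⁻¹ * e * d, ?_⟩
      rw [mul_smul, mul_smul, ← he, smul_smul, inv_mul_cancel₀ hc, one_smul]
  have hAne : ∀ h : LinearMap.ker f, h ≠ 0 → A h ≠ 0 := by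
    intro h hh h0
    obtain ⟨c, hc, h1⟩ := hAp h hh
    exact hp0 h (by simpa using hh) (by rw [h1, h0, smul_zero])
  have hfA : ∀ h, f' (A h) = 0 := fun h => by
    simp only [A]
    rw [map_sub, hP1 (hfa h), hP1 ha, sub_self]
  have hAsurj : ∀ y, f' y = 0 → ∃ h, A h = y := by
    intro y hy
    obtain ⟨v, hv, h1⟩ := hPsurj (y + P a) (by rw [map_add, hy, hP1 ha, zero_add])
    exact ⟨⟨v - a, by rw [LinearMap.mem_ker, map_sub, hv, ha, sub_self]⟩, by simp [A, h1]⟩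
  have hHrank := one_lt_rank_ker hrank f
  -- Parallelism: `h - k` is the direction both from `a + k` to `a + h` and from `a` to `a + (h -
  -- k)`, so both sides are multiples of `p (h - k)`.
  have hsub : ∀ h k, ∃ c : K, A h - A k = c • A (h - k) := by
    intro h k
    rcases eq_or_ne h k with rfl | hhk
    · exact ⟨0, by simp⟩
    obtain ⟨c, hc, h1⟩ := hAp (h - k) (sub_ne_zero.2 hhk)
    obtain ⟨d, hd, h2⟩ := hPsub (hfa h) (hfa k) (by simpa using hhk)
    refine ⟨d⁻¹ * c, ?_⟩
    rw [mul_smul, ← h1]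
    have h3 : ((h - k : LinearMap.ker f) : V) = a + h - (a + k) := by simp
    rw [h3, h2, smul_smul, inv_mul_cancel₀ hd, one_smul]
    simp [A]
  have hind : ∀ h k, LinearIndependent K ![h, k] → LinearIndependent K ![A h, A k] := by
    intro h k hhk
    have hh : h ≠ 0 := by simpa using hhk.ne_zero 0
    have hk : k ≠ 0 := by simpa using hhk.ne_zero 1
    rw [LinearIndependent.pair_iff' hh] at hhk
    rw [LinearIndependent.pair_iff' (hAne h hh)]
    intro c hc
    obtain ⟨d, hd⟩ := (hAprop k h hk hh).1 ⟨c, hc.symm⟩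
    exact hhk d hd.symm
  have hsmul : ∀ (c : K) h, ∃ d : K, A (c • h) = d • A h := by
    intro c h
    by_cases hch : c • h = 0
    · exact ⟨0, by rw [hch, hA0, zero_smul]⟩
    · exact (hAprop _ _ hch (right_ne_zero_of_smul hch)).2 ⟨c, rfl⟩
  have hsmul' : ∀ (d : K) h, ∃ c : K, A (c • h) = d • A h := by
    intro d h
    obtain ⟨k, hk⟩ := hAsurj (d • A h) (by rw [map_smul, hfA, smul_zero])
    by_cases hk0 : k = 0
    · exact ⟨0, by rw [← hk, hk0, zero_smul]⟩
    have hh : h ≠ 0 := by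
      rintro rfl
      rw [hA0, smul_zero] at hk
      exact hAne k hk0 hk
    obtain ⟨c, hc⟩ := (hAprop k h hk0 hh).1 ⟨d, hk⟩
    exact ⟨c, by rw [← hc, hk]⟩
  have hadd := map_add_of_sub_proportional hHrank hA0 hsub hind
  obtain ⟨τ, hτ⟩ := exists_ringEquiv_of_sub_proportional hHrank hA0 hsub hind hsmul hsmul'
  -- extension to the whole space
  let π : V →ₗ[K] LinearMap.ker f := (LinearMap.id - f.smulRight a).codRestrict _ (fun v => by
    simp [ha])
  have hπ : ∀ v, (π v : V) = v - f v • a := fun v => rfl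
  let F : V →+ V' := AddMonoidHom.mk' (fun v => τ (f v) • P a + A (π v)) (fun u v => by
    rw [map_add, map_add, map_add, hadd, add_smul]
    abel)
  have hF : ∀ v, F v = τ (f v) • P a + A (π v) := fun v => rfl
  have hFf : ∀ v, f' (F v) = τ (f v) := fun v => by
    rw [hF, map_add, map_smul, hP1 ha, hfA, smul_eq_mul, mul_one, add_zero]
  have hFinj : Function.Injective F := by
    rw [injective_iff_map_eq_zero]
    intro v hv
    have h1 := hFf v
    rw [hv, map_zero, eq_comm, map_eq_zero_iff τ τ.injective] at h1
    rw [hF, h1, map_zero, zero_smul, zero_add] at hv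
    have h2 : π v = 0 := by
      by_contra h
      exact hAne _ h hv
    have h3 := hπ v
    rw [h2, h1] at h3
    simpa using h3.symm
  have hFsurj : Function.Surjective F := by
    intro y
    obtain ⟨h, hh⟩ := hAsurj (y - f' y • P a) (by simp [hP1 ha])
    refine ⟨τ.symm (f' y) • a + h, ?_⟩
    have h1 : f (τ.symm (f' y) • a + h) = τ.symm (f' y) := by
      rw [map_add, map_smul, ha, LinearMap.mem_ker.1 h.2, smul_eq_mul, mul_one, add_zero]
    have h2 : π (τ.symm (f' y) • a + h) = h := by
      apply Subtype.ext
      rw [hπ, h1]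
      abel
    rw [hF, h1, h2, hh]
    simp
  have hFsmul : ∀ (c : K) v, F (c • v) = τ c • F v := by
    intro c v
    simp only [hF, map_smul, smul_eq_mul, map_mul, hτ, smul_add, smul_smul]
  refine ⟨τ, AddEquiv.ofBijective F ⟨hFinj, hFsurj⟩, hFsmul, ?_⟩
  intro v hv
  change ∃ c : K, p v = c • F v
  by_cases hfv : f v = 0
  · have h1 : (π v : V) = v := by rw [hπ, hfv, zero_smul, sub_zero]
    obtain ⟨c, -, hc⟩ := hAp (π v) (fun h => hv (by rw [← h1, h]; rfl))
    refine ⟨c, ?_⟩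
    rw [hF, hfv, map_zero, zero_smul, zero_add, ← hc, h1]
  -- Off the kernel, `v` is rescaled into the affine hyperplane, where `F` and `P` agree.
  · have h1 : f ((f v)⁻¹ • v) = 1 := by simpa using inv_mul_cancel₀ hfv
    obtain ⟨d, hd⟩ := (hprop hv (hne h1)).1
      ⟨f v, by rw [smul_smul, mul_inv_cancel₀ hfv, one_smul]⟩
    have h2 : P ((f v)⁻¹ • v) = F ((f v)⁻¹ • v) := by
      rw [hF, h1]
      simp only [A]
      rw [hπ, h1]
      simp
    rw [hPp h1, h2, hFsmul, smul_smul, smul_smul] at hd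
    exact ⟨_, hd⟩

/-- A functional vanishing on the common kernel of finitely many others is in their span. This
expresses collinearity through incidence, so incidence-preserving maps preserve lines. -/
theorem mem_span_pair_iff_of_injective {W : Type*} [AddCommGroup W] [Module K W]
    {B : V →ₗ[K] W →ₗ[K] K} (hB : Function.Injective B) (u v w : V) :
    u ∈ Submodule.span K {v, w} ↔ ∀ z, B v z = 0 → B w z = 0 → B u z = 0 := by
  constructor
  · intro h z hv hw
    obtain ⟨a, b, rfl⟩ := Submodule.mem_span_pair.1 h
    simp [hv, hw]
  · intro h
    have h1 : B u ∈ Submodule.span K (Set.range ![B v, B w]) := by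
      refine mem_span_of_iInf_ker_le_ker fun z hz => ?_
      simp only [Submodule.mem_iInf, LinearMap.mem_ker, Fin.forall_fin_two] at hz
      exact h z hz.1 hz.2
    rw [Matrix.range_cons, Matrix.range_cons, Matrix.range_empty, Set.union_empty,
      Set.singleton_union] at h1
    obtain ⟨a, b, h2⟩ := Submodule.mem_span_pair.1 h1
    exact Submodule.mem_span_pair.2 ⟨a, b, hB (by simpa using h2)⟩

/-- A bijection between the points of two spaces in duality and a compatible bijection of their
hyperplanes are induced by a semilinear bijection. -/
theorem exists_semilinear_of_incidence {W W' : Type*} [AddCommGroup W] [Module K W]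
    [AddCommGroup W'] [Module K W'] {B : V →ₗ[K] W →ₗ[K] K} {B' : V' →ₗ[K] W' →ₗ[K] K}
    (hB : Function.Injective B) (hB' : Function.Injective B')
    (hrank : 3 ≤ Module.rank K V) {p : V → V'} {q : W → W'}
    (hpsurj : ∀ y, y ≠ 0 → ∃ v, v ≠ 0 ∧ ∃ c : K, p v = c • y)
    (hqsurj : ∀ y, y ≠ 0 → ∃ w, w ≠ 0 ∧ ∃ c : K, y = c • q w)
    (hinc : ∀ v w, v ≠ 0 → w ≠ 0 → (B' (p v) (q w) = 0 ↔ B v w = 0)) :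
    ∃ (τ : K ≃+* K) (A : V ≃+ V'), (∀ (c : K) v, A (c • v) = τ c • A v) ∧
      (∀ v, v ≠ 0 → ∃ c : K, p v = c • A v) ∧
      ∀ w, w ≠ 0 → ∃ d : K, d ≠ 0 ∧ ∀ v, B' (A v) (q w) = d * τ (B v w) := by
  have hBne : ∀ v, v ≠ 0 → ∃ w, B v w ≠ 0 := by
    intro v hv
    by_contra! h
    exact hv (hB (by rw [map_zero]; exact LinearMap.ext h))
  have hp0 : ∀ v, v ≠ 0 → p v ≠ 0 := by
    intro v hv h
    obtain ⟨w, hw⟩ := hBne v hv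
    have hw0 : w ≠ 0 := by rintro rfl; simp at hw
    exact hw ((hinc v w hv hw0).1 (by rw [h]; simp))
  have hspan : ∀ u v w, u ≠ 0 → v ≠ 0 → w ≠ 0 →
      (u ∈ Submodule.span K {v, w} ↔ p u ∈ Submodule.span K {p v, p w}) := by
    intro u v w hu hv hw
    rw [mem_span_pair_iff_of_injective hB, mem_span_pair_iff_of_injective hB']
    constructor
    · intro h z' h1 h2
      rcases eq_or_ne z' 0 with rfl | hz'
      · simp
      obtain ⟨z, hz, c, rfl⟩ := hqsurj z' hz'
      have hc : c ≠ 0 := by rintro rfl; simp at hz'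
      simp only [map_smul, smul_eq_mul, mul_eq_zero, hc, false_or] at h1 h2 ⊢
      rw [hinc _ _ hv hz] at h1
      rw [hinc _ _ hw hz] at h2
      rw [hinc _ _ hu hz]
      exact h z h1 h2
    · intro h z h1 h2
      rcases eq_or_ne z 0 with rfl | hz
      · simp
      rw [← hinc _ _ hv hz] at h1
      rw [← hinc _ _ hw hz] at h2
      rw [← hinc _ _ hu hz]
      exact h _ h1 h2
  have : Nontrivial V := rank_pos_iff_nontrivial.1 (lt_of_lt_of_le (by norm_num) hrank)
  obtain ⟨v0, hv0⟩ := exists_ne (0 : V)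
  obtain ⟨w0, hw0⟩ := hBne v0 hv0
  have hw0' : w0 ≠ 0 := by rintro rfl; simp at hw0
  -- Any `w0` that pairs nontrivially can serve as the hyperplane at infinity.
  obtain ⟨τ, A, hA, hpA⟩ := exists_semilinear_of_span_iff hrank hp0 hspan hpsurj
    (f := B.flip w0) (f' := B'.flip (q w0))
    (fun h => hw0 (by simpa using LinearMap.congr_fun h v0))
    (fun v hv => by simpa using hinc v w0 hv hw0')
  refine ⟨τ, A, hA, hpA, fun w hw => ?_⟩
  have hker : ∀ v, B v w = 0 ↔ B' (A v) (q w) = 0 := by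
    intro v
    rcases eq_or_ne v 0 with rfl | hv
    · simp
    obtain ⟨c, hc⟩ := hpA v hv
    have hc0 : c ≠ 0 := by
      rintro rfl
      exact hp0 v hv (by simpa using hc)
    rw [← hinc v w hv hw, hc]
    simp [hc0]
  by_cases hall : ∀ v, B v w = 0
  -- `B` is injective only in its first argument, so a nonzero `w` may pair to zero with everything;
  -- any nonzero `d` then works.
  · exact ⟨1, one_ne_zero, fun v => by rw [(hker v).1 (hall v), hall v]; simp⟩
  push Not at hall
  obtain ⟨u, hu⟩ := hall
  have hu' := mt (hker u).2 hu
  have hτu : τ (B u w) ≠ 0 := by simpa using hu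
  -- Two `τ`-semilinear forms with the same kernel are proportional; the ratio is read off at `u`.
  refine ⟨B' (A u) (q w) / τ (B u w), div_ne_zero hu' hτu, fun v => ?_⟩
  have h1 := (hker (v - (B v w / B u w) • u)).1 (by simp [hu])
  rw [map_sub, hA, map_sub, map_smul, LinearMap.sub_apply, LinearMap.smul_apply, smul_eq_mul,
    map_div₀, sub_eq_zero] at h1
  rw [h1]
  field_simp

end ProjectiveGeometry

/-! ### Combinatorics of the two coordinates of a flag. -/

section FlagCombinatorics

/-- A surjection preserving "equal first or equal second coordinate" and "equal first and equal
second coordinate" either preserves the two coordinate relations or interchanges them. -/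
theorem coordinate_relations_preserved_or_swapped {F α β : Type*} {r : F → α} {k : F → β}
    {φ : F → F}
    (hor : ∀ T S, (r T = r S ∨ k T = k S) ↔ (r (φ T) = r (φ S) ∨ k (φ T) = k (φ S)))
    (hand : ∀ T S, (r T = r S ∧ k T = k S) ↔ (r (φ T) = r (φ S) ∧ k (φ T) = k (φ S)))
    (hr : ∀ T, ∃ S, r T = r S ∧ k T ≠ k S) (hk : ∀ T, ∃ S, k T = k S ∧ r T ≠ r S)
    (hconn : ∀ T S, ∃ U W, r T = r U ∧ k U = k W ∧ r W = r S) :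
    (∀ T S, (r T = r S ↔ r (φ T) = r (φ S)) ∧ (k T = k S ↔ k (φ T) = k (φ S))) ∨
      (∀ T S, (r T = r S ↔ k (φ T) = k (φ S)) ∧ (k T = k S ↔ r (φ T) = r (φ S))) := by
  -- If `S` and `U` violated the two alternatives, `φ S` would share only `k` and `φ U` only `r`
  -- with `φ T`. Yet `r S = r U` makes `φ S` and `φ U` share a coordinate, hence one of them would
  -- share both with `φ T`.
  have hDE : ∀ T, (∀ S, r T = r S → r (φ T) = r (φ S)) ∨ (∀ S, r T = r S → k (φ T) = k (φ S)) := by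
    intro T
    by_contra! h
    obtain ⟨⟨S, hS, hS'⟩, U, hU, hU'⟩ := h
    grind
  have hDE' : ∀ T, (∀ S, k T = k S → k (φ T) = k (φ S)) ∨
      (∀ S, k T = k S → r (φ T) = r (φ S)) := by
    intro T
    by_contra! h
    obtain ⟨⟨S, hS, hS'⟩, U, hU, hU'⟩ := h
    grind
  -- Were both classes of `T` sent into one class, an `S` sharing only `r` with `T` and a `U`
  -- sharing only `k` would have related images, though `S` and `U` share nothing.
  have hDD : ∀ T, (∀ S, r T = r S → r (φ T) = r (φ S)) ↔ (∀ S, k T = k S → k (φ T) = k (φ S)) := by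
    intro T
    obtain ⟨S, hS, hS'⟩ := hr T
    obtain ⟨U, hU, hU'⟩ := hk T
    constructor
    · intro h
      rcases hDE' T with h' | h'
      · exact h'
      · have := h S hS
        have := h' U hU
        grind
    · intro h
      rcases hDE T with h' | h'
      · exact h'
      · have := h U hU
        have := h' S hS
        grind
  have hstep : ∀ T S, r T = r S → (∀ U, r T = r U → r (φ T) = r (φ U)) →
      (∀ U, r S = r U → r (φ S) = r (φ U)) := by
    intro T S hTS h U hU
    rw [← h S hTS, h U (hTS.trans hU)]
  have hstep' : ∀ T S, k T = k S → (∀ U, r T = r U → r (φ T) = r (φ U)) →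
      (∀ U, r S = r U → r (φ S) = r (φ U)) := by
    intro T S hTS h
    rw [hDD] at h ⊢
    intro U hU
    rw [← h S hTS, h U (hTS.trans hU)]
  by_cases hD : ∃ T, ∀ S, r T = r S → r (φ T) = r (φ S)
  · left
    obtain ⟨T0, h0⟩ := hD
    have h1 : ∀ S U, r S = r U → r (φ S) = r (φ U) := by
      intro S
      obtain ⟨U, W, hU, hUW, hW⟩ := hconn T0 S
      exact hstep _ _ hW (hstep' _ _ hUW (hstep _ _ hU h0))
    have h2 : ∀ S U, k S = k U → k (φ S) = k (φ U) := fun S => (hDD S).1 (h1 S)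
    -- For the converses: `r (φ T) = r (φ S)` gives `r T = r S` or `k T = k S` by `hor`; in the
    -- second case `h2` and `hand` apply.
    grind
  · right
    push Not at hD
    have h1 : ∀ S U, r S = r U → k (φ S) = k (φ U) := fun S => (hDE S).resolve_left (by
      push Not
      exact hD S)
    have h2 : ∀ S U, k S = k U → r (φ S) = r (φ U) := fun S => (hDE' S).resolve_left (by
      rw [← hDD]
      push Not
      exact hD S)
    grind

end FlagCombinatorics

/-! ### Rank-one nilpotents as flags. -/

section RankOneNilpotents

variable {X : Type*} [NormedAddCommGroup X] [NormedSpace ℂ X]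

theorem range_smulRight {f : StrongDual ℂ X} (hf : f ≠ 0) (x : X) :
    LinearMap.range ((f.smulRight x : X →L[ℂ] X) : X →ₗ[ℂ] X) = Submodule.span ℂ {x} := by
  obtain ⟨z, hz⟩ := DFunLike.ne_iff.1 hf
  replace hz : f z ≠ 0 := hz
  ext y
  simp only [LinearMap.mem_range, Submodule.mem_span_singleton, ContinuousLinearMap.coe_coe,
    ContinuousLinearMap.smulRight_apply]
  constructor
  · rintro ⟨u, rfl⟩
    exact ⟨_, rfl⟩
  · rintro ⟨c, rfl⟩
    exact ⟨(c / f z) • z, by simp [hz]⟩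

theorem ker_smulRight (f : StrongDual ℂ X) {x : X} (hx : x ≠ 0) :
    LinearMap.ker ((f.smulRight x : X →L[ℂ] X) : X →ₗ[ℂ] X) =
      LinearMap.ker (f : X →ₗ[ℂ] ℂ) := by
  ext y
  simp [hx]

theorem smulRight_mem_rankOneNilpotents {f : StrongDual ℂ X} {x : X} (hf : f ≠ 0) (hx : x ≠ 0)
    (hfx : f x = 0) : f.smulRight x ∈ rankOneNilpotents X := by
  constructor
  · rw [LinearMap.rank, range_smulRight hf, rank_submodule_eq_one_iff]
    exact ⟨x, Submodule.mem_span_singleton_self x, hx, le_rfl⟩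
  · refine ⟨2, ?_⟩
    ext y
    simp [pow_two, hfx]

theorem exists_smulRight_of_mem_rankOneNilpotents {T : X →L[ℂ] X}
    (hT : T ∈ rankOneNilpotents X) :
    ∃ (x : X) (f : StrongDual ℂ X), x ≠ 0 ∧ f ≠ 0 ∧ f x = 0 ∧ T = f.smulRight x := by
  obtain ⟨hrank, m, hm⟩ := hT
  obtain ⟨x, -, hx, hle⟩ := (rank_submodule_eq_one_iff _).1 hrank
  obtain ⟨g, hg⟩ := SeparatingDual.exists_eq_one (R := ℂ) hx
  have hTf : T = (g.comp T).smulRight x := by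
    ext y
    obtain ⟨c, hc⟩ := Submodule.mem_span_singleton.1 (hle ⟨y, rfl⟩)
    replace hc : c • x = T y := hc
    simp [← hc, hg]
  obtain ⟨f, hf⟩ : ∃ f, f = g.comp T := ⟨_, rfl⟩
  rw [← hf] at hTf
  refine ⟨x, f, hx, ?_, ?_, hTf⟩
  · rintro rfl
    have hT0 : T = 0 := by
      rw [hTf]
      ext y
      simp
    rw [hT0, ContinuousLinearMap.toLinearMap_zero, LinearMap.rank_zero] at hrank
    exact zero_ne_one hrank
  · have hpow : ∀ j : ℕ, (T ^ j) x = (f x) ^ j • x := by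
      intro j
      induction j with
      | zero => simp
      | succ j ih =>
        rw [pow_succ', mul_apply_eq_comp, ih, map_smul, hTf]
        simp [pow_succ, mul_smul]
    have h1 := hpow m
    rw [hm, zero_apply, eq_comm, smul_eq_zero] at h1
    exact eq_zero_of_pow_eq_zero (h1.resolve_right hx)

/-- The canonical pairing of a normed space with its dual. -/
noncomputable def evalPairing (X : Type*) [NormedAddCommGroup X] [NormedSpace ℂ X] :
    X →ₗ[ℂ] StrongDual ℂ X →ₗ[ℂ] ℂ :=
  LinearMap.flip (ContinuousLinearMap.coeLM ℂ)

@[simp]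
theorem evalPairing_apply (x : X) (f : StrongDual ℂ X) : evalPairing X x f = f x := rfl

theorem evalPairing_injective : Function.Injective (evalPairing X) := by
  rw [injective_iff_map_eq_zero]
  intro x hx
  by_contra h
  obtain ⟨f, hf⟩ := SeparatingDual.exists_ne_zero (R := ℂ) h
  exact hf (LinearMap.congr_fun hx f)

theorem evalPairing_flip_injective : Function.Injective (evalPairing X).flip := by
  rw [injective_iff_map_eq_zero]
  intro f hf
  ext x
  exact LinearMap.congr_fun hf x

theorem ker_eq_ker_iff_span_eq_span (f g : StrongDual ℂ X) :
    LinearMap.ker (f : X →ₗ[ℂ] ℂ) = LinearMap.ker (g : X →ₗ[ℂ] ℂ) ↔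
      Submodule.span ℂ {f} = Submodule.span ℂ {g} := by
  have key : ∀ f g : StrongDual ℂ X, Submodule.span ℂ {f} ≤ Submodule.span ℂ {g} ↔
      LinearMap.ker (g : X →ₗ[ℂ] ℂ) ≤ LinearMap.ker (f : X →ₗ[ℂ] ℂ) := by
    intro f g
    rw [Submodule.span_singleton_le_iff_mem, ← Set.pair_eq_singleton g,
      mem_span_pair_iff_of_injective evalPairing_flip_injective]
    exact ⟨fun h x hx => h x hx hx, fun h x hx _ => h hx⟩
  rw [le_antisymm_iff, le_antisymm_iff, key, key, and_comm]

theorem exists_smul_eq_of_span_eq_span {K V : Type*} [Field K] [AddCommGroup V] [Module K V]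
    {x y : V} (h : Submodule.span K {x} = Submodule.span K {y}) : ∃ c : K, x = c • y := by
  obtain ⟨c, hc⟩ := Submodule.mem_span_singleton.1
    (h ▸ Submodule.mem_span_singleton_self x : x ∈ Submodule.span K {y})
  exact ⟨c, hc.symm⟩

/-- Otherwise `x` and `y` would span `X`. Any two points thus lie on a common hyperplane, which
connects all flags. -/
theorem exists_dual_ne_zero_apply_eq_zero_pair (hdim : 3 ≤ Module.rank ℂ X) (x y : X) :
    ∃ f : StrongDual ℂ X, f ≠ 0 ∧ f x = 0 ∧ f y = 0 := by
  by_contra! h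
  have htop : Submodule.span ℂ {x, y} = ⊤ := by
    rw [eq_top_iff]
    rintro z -
    rw [mem_span_pair_iff_of_injective evalPairing_injective]
    intro f hx hy
    by_contra hz
    exact h f (by rintro rfl; simp at hz) hx hy
  have h1 := rank_span_le (R := ℂ) ({x, y} : Set X)
  rw [htop, rank_top] at h1
  have h2 : Cardinal.mk ({x, y} : Set X) ≤ 2 := by
    refine (Cardinal.mk_insert_le).trans ?_
    rw [Cardinal.mk_singleton]
    norm_num
  have := hdim.trans (h1.trans h2)
  norm_num at this

theorem exists_linearIndependent_apply_eq_zero (hdim : 3 ≤ Module.rank ℂ X) {f : StrongDual ℂ X}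
    {x : X} (hx : x ≠ 0) (hfx : f x = 0) : ∃ y, LinearIndependent ℂ ![x, y] ∧ f y = 0 := by
  obtain ⟨y, hy⟩ := exists_linearIndependent_pair_of_one_lt_rank
    (one_lt_rank_ker hdim (f : X →ₗ[ℂ] ℂ)) (x := ⟨x, hfx⟩)
    (fun h => hx (congrArg Subtype.val h))
  refine ⟨y, ?_, y.2⟩
  rw [LinearIndependent.pair_iff] at hy ⊢
  exact fun s t hst => hy s t (Subtype.ext hst)

theorem three_le_rank_strongDual (hdim : 3 ≤ Module.rank ℂ X) :
    3 ≤ Module.rank ℂ (StrongDual ℂ X) := by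
  by_contra! h
  have hfin : Module.Finite ℂ (StrongDual ℂ X) :=
    Module.rank_lt_aleph0_iff.1 (h.trans (Cardinal.ofNat_lt_aleph0))
  have h1 := LinearMap.rank_le_of_injective
    (evalPairing X : X →ₗ[ℂ] Module.Dual ℂ (StrongDual ℂ X)) evalPairing_injective
  have h2 : Module.rank ℂ (Module.Dual ℂ (StrongDual ℂ X)) = Module.rank ℂ (StrongDual ℂ X) := by
    rw [← Module.finrank_eq_rank, ← Module.finrank_eq_rank, Subspace.dual_finrank_eq]
  rw [h2] at h1
  exact absurd (hdim.trans h1) (not_le.2 h)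

theorem ne_zero_of_mem_rankOneNilpotents {T : X →L[ℂ] X} (hT : T ∈ rankOneNilpotents X) :
    T ≠ 0 := by
  rintro rfl
  have := hT.1
  rw [ContinuousLinearMap.toLinearMap_zero, LinearMap.rank_zero] at this
  exact zero_ne_one this

theorem linDepPair_iff {T S : X →L[ℂ] X} (hT : T ∈ rankOneNilpotents X)
    (hS : S ∈ rankOneNilpotents X) :
    LinDepPair T S ↔ LinearMap.range (T : X →ₗ[ℂ] X) = LinearMap.range (S : X →ₗ[ℂ] X) ∧
      LinearMap.ker (T : X →ₗ[ℂ] X) = LinearMap.ker (S : X →ₗ[ℂ] X) := by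
  rw [LinDepPair, LinearIndependent.pair_iff' (ne_zero_of_mem_rankOneNilpotents hT)]
  push Not
  constructor
  · rintro ⟨a, rfl⟩
    have ha : a ≠ 0 := by
      rintro rfl
      exact ne_zero_of_mem_rankOneNilpotents hS (zero_smul _ _)
    rw [ContinuousLinearMap.toLinearMap_smul, LinearMap.range_smul _ _ ha,
      LinearMap.ker_smul _ _ ha]
    exact ⟨rfl, rfl⟩
  · obtain ⟨x, f, hx, hf, -, rfl⟩ := exists_smulRight_of_mem_rankOneNilpotents hT
    obtain ⟨y, g, hy, hg, -, rfl⟩ := exists_smulRight_of_mem_rankOneNilpotents hS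
    rw [range_smulRight hf, range_smulRight hg, ker_smulRight _ hx, ker_smulRight _ hy,
      ker_eq_ker_iff_span_eq_span]
    rintro ⟨h1, h2⟩
    obtain ⟨c, rfl⟩ := exists_smul_eq_of_span_eq_span h1.symm
    obtain ⟨d, rfl⟩ := exists_smul_eq_of_span_eq_span h2.symm
    exact ⟨c * d, by ext z; simp [smul_smul]; ring_nf⟩

/-- Let the flags of a pairing `B` be put in correspondence with the rank-one nilpotents in such a
way that `φ` turns the two coordinates into range and kernel. Then `φ` is induced by a semilinear
bijection. -/
theorem exists_semilinear_of_flag_coordinates {V W : Type*} [AddCommGroup V] [Module ℂ V]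
    [AddCommGroup W] [Module ℂ W] {B : V →ₗ[ℂ] W →ₗ[ℂ] ℂ} (hB : Function.Injective B)
    (hdim : 3 ≤ Module.rank ℂ X) (hrank : 3 ≤ Module.rank ℂ V)
    {φ : rankOneNilpotents X → rankOneNilpotents X} (hφ : Function.Surjective φ)
    {a : rankOneNilpotents X → V} {b : rankOneNilpotents X → W}
    (ha0 : ∀ T, a T ≠ 0) (hb0 : ∀ T, b T ≠ 0) (hab : ∀ T, B (a T) (b T) = 0)
    (ha : ∀ v, v ≠ 0 → ∃ T, Submodule.span ℂ {a T} = Submodule.span ℂ {v})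
    (hb : ∀ w, w ≠ 0 → ∃ T, Submodule.span ℂ {b T} = Submodule.span ℂ {w})
    (hflag : ∀ v w, v ≠ 0 → w ≠ 0 → B v w = 0 →
      ∃ T, Submodule.span ℂ {a T} = Submodule.span ℂ {v} ∧
        Submodule.span ℂ {b T} = Submodule.span ℂ {w})
    (hr : ∀ T S, Submodule.span ℂ {a T} = Submodule.span ℂ {a S} ↔
      LinearMap.range ((φ T : X →L[ℂ] X) : X →ₗ[ℂ] X) =
        LinearMap.range ((φ S : X →L[ℂ] X) : X →ₗ[ℂ] X))
    (hk : ∀ T S, Submodule.span ℂ {b T} = Submodule.span ℂ {b S} ↔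
      LinearMap.ker ((φ T : X →L[ℂ] X) : X →ₗ[ℂ] X) =
        LinearMap.ker ((φ S : X →L[ℂ] X) : X →ₗ[ℂ] X)) :
    ∃ (τ : ℂ ≃+* ℂ) (A : V ≃+ X), (∀ (c : ℂ) v, A (c • v) = τ c • A v) ∧
      (∀ w, ∃ g : StrongDual ℂ X, ∀ v, g (A v) = τ (B v w)) ∧
      ∀ T, ∃ c : ℂˣ, ∀ v, (φ T : X →L[ℂ] X) (A v) = (c : ℂ) • A (B v (b T) • a T) := by
  choose vec fn hvec hfn hfv hrep using
    fun T : rankOneNilpotents X => exists_smulRight_of_mem_rankOneNilpotents T.2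
  have hrange : ∀ T : rankOneNilpotents X, LinearMap.range ((T : X →L[ℂ] X) : X →ₗ[ℂ] X) =
      Submodule.span ℂ {vec T} := fun T => by
    conv_lhs => rw [hrep T]
    exact range_smulRight (hfn T) _
  have hker : ∀ T S : rankOneNilpotents X, LinearMap.ker ((T : X →L[ℂ] X) : X →ₗ[ℂ] X) =
      LinearMap.ker ((S : X →L[ℂ] X) : X →ₗ[ℂ] X) ↔
      Submodule.span ℂ {fn T} = Submodule.span ℂ {fn S} := fun T S => by
    conv_lhs => rw [hrep T, hrep S]
    rw [ker_smulRight _ (hvec T), ker_smulRight _ (hvec S), ker_eq_ker_iff_span_eq_span]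
  have hmk : ∀ (f : StrongDual ℂ X) (x : X), f ≠ 0 → x ≠ 0 → f x = 0 →
      ∃ T : rankOneNilpotents X, Submodule.span ℂ {vec T} = Submodule.span ℂ {x} ∧
        Submodule.span ℂ {fn T} = Submodule.span ℂ {f} := by
    intro f x hf hx hfx
    refine ⟨⟨_, smulRight_mem_rankOneNilpotents hf hx hfx⟩, ?_, ?_⟩
    · rw [← hrange, range_smulRight hf]
    · rw [← ker_eq_ker_iff_span_eq_span, ← ker_smulRight _ (hvec _), ← hrep, ker_smulRight _ hx]
  have hzero : ∀ {f g : StrongDual ℂ X} {x y : X}, Submodule.span ℂ {f} = Submodule.span ℂ {g} →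
      Submodule.span ℂ {x} = Submodule.span ℂ {y} → g y = 0 → f x = 0 := by
    intro f g x y h1 h2 h3
    obtain ⟨c, rfl⟩ := exists_smul_eq_of_span_eq_span h1
    obtain ⟨d, rfl⟩ := exists_smul_eq_of_span_eq_span h2
    simp [h3]
  simp only [hrange] at hr
  simp only [hker] at hk
  choose Tv hTv using ha
  choose Tw hTw using hb
  classical
  -- The line of `p v` does not depend on the chosen flag through `v`, by `hr`; likewise for `q` by
  -- `hk`. The value at zero is a filler.
  let p : V → X := fun v => if h : v = 0 then 0 else vec (φ (Tv v h))
  let q : W → StrongDual ℂ X := fun w => if h : w = 0 then 0 else fn (φ (Tw w h))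
  have hp : ∀ T v, v ≠ 0 → (Submodule.span ℂ {a T} = Submodule.span ℂ {v} ↔
      Submodule.span ℂ {vec (φ T)} = Submodule.span ℂ {p v}) := by
    intro T v hv
    simp only [p, dif_neg hv]
    rw [← hr, hTv]
  have hq : ∀ T w, w ≠ 0 → (Submodule.span ℂ {b T} = Submodule.span ℂ {w} ↔
      Submodule.span ℂ {fn (φ T)} = Submodule.span ℂ {q w}) := by
    intro T w hw
    simp only [q, dif_neg hw]
    rw [← hk, hTw]
  have hp0 : ∀ v, v ≠ 0 → p v ≠ 0 := fun v hv => by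
    simp only [p, dif_neg hv]
    exact hvec _
  have hq0 : ∀ w, w ≠ 0 → q w ≠ 0 := fun w hw => by
    simp only [q, dif_neg hw]
    exact hfn _
  have hpsurj : ∀ y, y ≠ 0 → ∃ v, v ≠ 0 ∧ ∃ c : ℂ, p v = c • y := by
    intro y hy
    obtain ⟨f, hf, hfy, -⟩ := exists_dual_ne_zero_apply_eq_zero_pair hdim y y
    obtain ⟨T, hT, -⟩ := hmk f y hf hy hfy
    obtain ⟨S, rfl⟩ := hφ T
    exact ⟨a S, ha0 S, exists_smul_eq_of_span_eq_span
      (((hp S _ (ha0 S)).1 rfl).symm.trans hT)⟩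
  have hqsurj : ∀ y, y ≠ 0 → ∃ w, w ≠ 0 ∧ ∃ c : ℂ, y = c • q w := by
    intro g hg
    have hX : Nontrivial (LinearMap.ker (g : X →ₗ[ℂ] ℂ)) :=
      rank_pos_iff_nontrivial.1 (zero_lt_one.trans (one_lt_rank_ker hdim _))
    obtain ⟨⟨x, hgx⟩, hx⟩ := exists_ne (0 : LinearMap.ker (g : X →ₗ[ℂ] ℂ))
    obtain ⟨T, -, hT⟩ := hmk g x hg (by simpa using hx) hgx
    obtain ⟨S, rfl⟩ := hφ T
    exact ⟨b S, hb0 S, exists_smul_eq_of_span_eq_span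
      (hT.symm.trans ((hq S _ (hb0 S)).1 rfl))⟩
  have hinc : ∀ v w, v ≠ 0 → w ≠ 0 → (evalPairing X (p v) (q w) = 0 ↔ B v w = 0) := by
    intro v w hv hw
    rw [evalPairing_apply]
    constructor
    · intro h
      obtain ⟨T, hT1, hT2⟩ := hmk _ _ (hq0 w hw) (hp0 v hv) h
      obtain ⟨S, rfl⟩ := hφ T
      obtain ⟨c, rfl⟩ := exists_smul_eq_of_span_eq_span ((hp S v hv).2 hT1).symm
      obtain ⟨d, rfl⟩ := exists_smul_eq_of_span_eq_span ((hq S w hw).2 hT2).symm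
      simp [hab]
    · intro h
      obtain ⟨T, hT1, hT2⟩ := hflag v w hv hw h
      exact hzero ((hq T w hw).1 hT2).symm ((hp T v hv).1 hT1).symm (hfv _)
  obtain ⟨τ, A, hA, hpA, hqA⟩ := exists_semilinear_of_incidence hB
    (evalPairing_injective (X := X)) hrank hpsurj hqsurj hinc
  refine ⟨τ, A, hA, fun w => ?_, fun T => ?_⟩
  · rcases eq_or_ne w 0 with rfl | hw
    · exact ⟨0, by simp⟩
    obtain ⟨d, hd, h⟩ := hqA w hw
    refine ⟨d⁻¹ • q w, fun v => ?_⟩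
    have h1 := h v
    rw [evalPairing_apply] at h1
    rw [smul_apply, h1, smul_eq_mul, inv_mul_cancel_left₀ hd]
  · obtain ⟨c, hc⟩ := hpA (a T) (ha0 T)
    obtain ⟨d, -, hd⟩ := hqA (b T) (hb0 T)
    obtain ⟨e, he⟩ := exists_smul_eq_of_span_eq_span ((hp T _ (ha0 T)).1 rfl)
    obtain ⟨e', he'⟩ := exists_smul_eq_of_span_eq_span ((hq T _ (hb0 T)).1 rfl)
    have key : ∀ v, (φ T : X →L[ℂ] X) (A v) = (e' * d * e * c) • A (B v (b T) • a T) := by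
      intro v
      have h1 := hd v
      rw [evalPairing_apply] at h1
      rw [hrep (φ T), ContinuousLinearMap.smulRight_apply, he, he', hc, smul_apply, h1, hA]
      simp only [smul_smul, smul_eq_mul]
      congr 1
      ring
    refine ⟨Units.mk0 _ fun h0 => ne_zero_of_mem_rankOneNilpotents (φ T).2 ?_, key⟩
    ext x
    obtain ⟨v, rfl⟩ := A.surjective x
    rw [key, h0, zero_smul, zero_apply]

/-- Surjective maps of rank-one nilpotents that preserve linear dependence and the relation "same
range or same kernel" are induced by semilinear bijections. -/
theorem exists_semilinear_of_preserves_linDepPair_sameRangeOrKer (hdim : 3 ≤ Module.rank ℂ X)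
    {φ : rankOneNilpotents X → rankOneNilpotents X} (hφ : Function.Surjective φ)
    (hdep : ∀ T S : rankOneNilpotents X, LinDepPair (T : X →L[ℂ] X) (S : X →L[ℂ] X) ↔
      LinDepPair (φ T : X →L[ℂ] X) (φ S : X →L[ℂ] X))
    (hsim : ∀ T S : rankOneNilpotents X, SameRangeOrKer (T : X →L[ℂ] X) (S : X →L[ℂ] X) ↔
      SameRangeOrKer (φ T : X →L[ℂ] X) (φ S : X →L[ℂ] X)) :
    (∃ (τ : ℂ ≃+* ℂ) (A : X ≃+ X), (∀ (c : ℂ) x, A (c • x) = τ c • A x) ∧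
      (∀ f : StrongDual ℂ X, ∃ g : StrongDual ℂ X, ∀ x, g (A x) = τ (f x)) ∧
      ∀ T, ∃ c : ℂˣ, ∀ x, (φ T : X →L[ℂ] X) (A x) = (c : ℂ) • A ((T : X →L[ℂ] X) x)) ∨
    (∃ (τ : ℂ ≃+* ℂ) (A : StrongDual ℂ X ≃+ X), (∀ (c : ℂ) f, A (c • f) = τ c • A f) ∧
      (∀ x : X, ∃ g : StrongDual ℂ X, ∀ f, g (A f) = τ (f x)) ∧
      ∀ T, ∃ c : ℂˣ, ∀ f, (φ T : X →L[ℂ] X) (A f) =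
        (c : ℂ) • A (dualOperator (T : X →L[ℂ] X) f)) := by
  choose vec fn hvec hfn hfv hrep using
    fun T : rankOneNilpotents X => exists_smulRight_of_mem_rankOneNilpotents T.2
  have hrange : ∀ T S : rankOneNilpotents X, LinearMap.range ((T : X →L[ℂ] X) : X →ₗ[ℂ] X) =
      LinearMap.range ((S : X →L[ℂ] X) : X →ₗ[ℂ] X) ↔
      Submodule.span ℂ {vec T} = Submodule.span ℂ {vec S} := fun T S => by
    conv_lhs => rw [hrep T, hrep S]
    rw [range_smulRight (hfn T), range_smulRight (hfn S)]
  have hker : ∀ T S : rankOneNilpotents X, LinearMap.ker ((T : X →L[ℂ] X) : X →ₗ[ℂ] X) =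
      LinearMap.ker ((S : X →L[ℂ] X) : X →ₗ[ℂ] X) ↔
      Submodule.span ℂ {fn T} = Submodule.span ℂ {fn S} := fun T S => by
    conv_lhs => rw [hrep T, hrep S]
    rw [ker_smulRight _ (hvec T), ker_smulRight _ (hvec S), ker_eq_ker_iff_span_eq_span]
  have hmk : ∀ (f : StrongDual ℂ X) (x : X), f ≠ 0 → x ≠ 0 → f x = 0 →
      ∃ T : rankOneNilpotents X, Submodule.span ℂ {vec T} = Submodule.span ℂ {x} ∧
        Submodule.span ℂ {fn T} = Submodule.span ℂ {f} := by
    intro f x hf hx hfx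
    refine ⟨⟨_, smulRight_mem_rankOneNilpotents hf hx hfx⟩, ?_, ?_⟩
    · rw [← range_smulRight (hfn _), ← hrep, range_smulRight hf]
    · rw [← ker_eq_ker_iff_span_eq_span, ← ker_smulRight _ (hvec _), ← hrep, ker_smulRight _ hx]
  have hvecsurj : ∀ x, x ≠ 0 → ∃ T, Submodule.span ℂ {vec T} = Submodule.span ℂ {x} := by
    intro x hx
    obtain ⟨f, hf, hfx, -⟩ := exists_dual_ne_zero_apply_eq_zero_pair hdim x x
    obtain ⟨T, hT, -⟩ := hmk f x hf hx hfx
    exact ⟨T, hT⟩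
  have hfnsurj : ∀ f, f ≠ 0 → ∃ T, Submodule.span ℂ {fn T} = Submodule.span ℂ {f} := by
    intro g hg
    have hX : Nontrivial (LinearMap.ker (g : X →ₗ[ℂ] ℂ)) :=
      rank_pos_iff_nontrivial.1 (zero_lt_one.trans (one_lt_rank_ker hdim _))
    obtain ⟨⟨x, hgx⟩, hx⟩ := exists_ne (0 : LinearMap.ker (g : X →ₗ[ℂ] ℂ))
    obtain ⟨T, -, hT⟩ := hmk g x hg (by simpa using hx) hgx
    exact ⟨T, hT⟩
  have hspan_ne : ∀ {x y : X}, LinearIndependent ℂ ![x, y] →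
      Submodule.span ℂ {x} ≠ Submodule.span ℂ {y} := by
    intro x y hxy h
    obtain ⟨c, hc⟩ := exists_smul_eq_of_span_eq_span h.symm
    exact (LinearIndependent.pair_iff' (by simpa using hxy.ne_zero 0)).1 hxy c hc.symm
  simp only [linDepPair_iff (Subtype.prop _) (Subtype.prop _)] at hdep
  have h := coordinate_relations_preserved_or_swapped
    (r := fun T : rankOneNilpotents X => LinearMap.range ((T : X →L[ℂ] X) : X →ₗ[ℂ] X))
    (k := fun T : rankOneNilpotents X => LinearMap.ker ((T : X →L[ℂ] X) : X →ₗ[ℂ] X))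
    hsim hdep ?_ ?_ ?_
  · simp only [hrange, hker] at h
    rcases h with h | h
    · left
      obtain ⟨τ, A, hA, hAf, hAφ⟩ := exists_semilinear_of_flag_coordinates (a := vec) (b := fn)
        evalPairing_injective hdim hdim hφ hvec hfn hfv hvecsurj hfnsurj
        (fun x f hx hf hfx => hmk f x hf hx hfx)
        (fun T S => (h T S).1.trans (hrange _ _).symm) (fun T S => (h T S).2.trans (hker _ _).symm)
      refine ⟨τ, A, hA, hAf, fun T => ?_⟩
      obtain ⟨c, hc⟩ := hAφ T
      refine ⟨c, fun x => ?_⟩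
      rw [hc, hrep T]
      rfl
    · right
      -- In the swapped case functionals play the role of points, under the flipped pairing.
      obtain ⟨τ, A, hA, hAf, hAφ⟩ := exists_semilinear_of_flag_coordinates (a := fn) (b := vec)
        evalPairing_flip_injective hdim (three_le_rank_strongDual hdim) hφ hfn hvec hfv hfnsurj
        hvecsurj (fun f x hf hx hfx => (hmk f x hf hx hfx).imp fun T hT => hT.symm)
        (fun T S => (h T S).2.trans (hrange _ _).symm) (fun T S => (h T S).1.trans (hker _ _).symm)
      refine ⟨τ, A, hA, hAf, fun T => ?_⟩
      obtain ⟨c, hc⟩ := hAφ T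
      refine ⟨c, fun f => ?_⟩
      rw [hc]
      congr 2
      ext x
      rw [dualOperator, hrep T]
      simp [mul_comm]
  · intro T
    simp only [hrange, hker, ne_eq]
    obtain ⟨y, hy, hfy⟩ := exists_linearIndependent_apply_eq_zero hdim (hvec T) (hfv T)
    obtain ⟨g, hg, hgx, hgy⟩ : ∃ g : StrongDual ℂ X, g ≠ 0 ∧ g (vec T) = 0 ∧ g y ≠ 0 := by
      have h1 : y ∉ Submodule.span ℂ {vec T, vec T} := by
        rw [Set.pair_eq_singleton, Submodule.mem_span_singleton]
        rintro ⟨c, hc⟩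
        exact (LinearIndependent.pair_iff' (hvec T)).1 hy c hc
      rw [mem_span_pair_iff_of_injective evalPairing_injective] at h1
      push Not at h1
      obtain ⟨g, h2, -, h3⟩ := h1
      exact ⟨g, by rintro rfl; simp at h3, h2, h3⟩
    obtain ⟨S, hS1, hS2⟩ := hmk g (vec T) hg (hvec T) hgx
    refine ⟨S, hS1.symm, fun h => hgy ?_⟩
    obtain ⟨c, rfl⟩ := exists_smul_eq_of_span_eq_span (hS2.symm.trans h.symm)
    simp [hfy]
  · intro T
    simp only [hrange, hker, ne_eq]
    obtain ⟨y, hy, hfy⟩ := exists_linearIndependent_apply_eq_zero hdim (hvec T) (hfv T)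
    obtain ⟨S, hS1, hS2⟩ := hmk (fn T) y (hfn T) (by simpa using hy.ne_zero 1) hfy
    exact ⟨S, hS2.symm, fun h => hspan_ne hy (h.trans hS1)⟩
  · intro T S
    simp only [hrange, hker]
    obtain ⟨f, hf, h1, h2⟩ := exists_dual_ne_zero_apply_eq_zero_pair hdim (vec T) (vec S)
    obtain ⟨U, hU1, hU2⟩ := hmk f (vec T) hf (hvec T) h1
    obtain ⟨W, hW1, hW2⟩ := hmk f (vec S) hf (hvec S) h2
    exact ⟨U, W, hU1.symm, hU2.trans hW2.symm, hW1⟩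

end RankOneNilpotents

/-! ### Automatic continuity in infinite dimension. -/

section BoundedSemilinear

open Filter Topology

variable {X : Type*} [NormedAddCommGroup X] [NormedSpace ℂ X]

/-- Inductively, the common kernel of the earlier functionals is infinite-dimensional, so it
contains a `y` outside the span of the earlier vectors. Some functional kills those vectors but not
`y`, and is rescaled. -/
theorem exists_biorthogonal_sequence (hinf : ¬ FiniteDimensional ℂ X) :
    ∃ (x : ℕ → X) (f : ℕ → StrongDual ℂ X), ∀ m n, f m (x n) = if m = n then 1 else 0 := by
  obtain ⟨u, hu1, hu2⟩ := exists_seq_of_forall_finset_exists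
    (fun p : X × StrongDual ℂ X => p.2 p.1 = 1) (fun p q => p.2 q.1 = 0 ∧ q.2 p.1 = 0) (by
      intro s _
      let L : X →ₗ[ℂ] (s → ℂ) := LinearMap.pi fun p => ((p : X × StrongDual ℂ X).2 : X →ₗ[ℂ] ℂ)
      obtain ⟨y, hy, hys⟩ : ∃ y, L y = 0 ∧
          y ∉ Submodule.span ℂ (Set.range fun p : s => (p : X × StrongDual ℂ X).1) := by
        by_contra! h
        refine hinf (Module.finite_def.2 (Submodule.fg_of_fg_map_of_fg_inf_ker L
          (IsNoetherian.noetherian _) ?_))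
        have hfin := FiniteDimensional.span_of_finite ℂ
          (Set.finite_range fun p : s => (p : X × StrongDual ℂ X).1)
        have hker : FiniteDimensional ℂ (LinearMap.ker L) :=
          Submodule.finiteDimensional_of_le (fun y hy => h y hy)
        rw [top_inf_eq]
        exact (Submodule.fg_iff_finiteDimensional _).2 hker
      obtain ⟨g, hg, hgy⟩ : ∃ g : StrongDual ℂ X, (∀ p : s, g (p : X × StrongDual ℂ X).1 = 0) ∧
          g y ≠ 0 := by
        by_contra! h
        have h1 : evalPairing X y ∈ Submodule.span ℂ
            (Set.range fun p : s => evalPairing X (p : X × StrongDual ℂ X).1) := by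
          refine mem_span_of_iInf_ker_le_ker fun g hg => ?_
          simp only [Submodule.mem_iInf, LinearMap.mem_ker] at hg
          exact h g hg
        rw [Set.range_comp' (evalPairing X) (fun p : s => (p : X × StrongDual ℂ X).1),
          ← Submodule.map_span] at h1
        obtain ⟨z, hz, hzy⟩ := h1
        exact hys (evalPairing_injective hzy ▸ hz)
      refine ⟨(y, (g y)⁻¹ • g), by simp [hgy], fun p hp => ⟨congrFun hy ⟨p, hp⟩, ?_⟩⟩
      simp [hg ⟨p, hp⟩])
  refine ⟨fun n => (u n).1, fun n => (u n).2, fun m n => ?_⟩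
  split_ifs with h
  · rw [h]
    exact hu1 n
  · rcases lt_or_gt_of_ne h with h | h
    · exact (hu2 m n h).1
    · exact (hu2 n m h).2

/-- Since `τ` fixes the integers, the bound at `n * a` gives a bound `M / n` at `a`. -/
theorem continuous_of_bounded_near_zero {τ : ℂ ≃+* ℂ} {ε M : ℝ} (hε : 0 < ε)
    (h : ∀ a, ‖a‖ ≤ ε → ‖τ a‖ ≤ M) : Continuous τ := by
  refine continuous_of_continuousAt_zero τ ?_
  rw [ContinuousAt, map_zero, Metric.tendsto_nhds_nhds]
  intro δ hδ
  obtain ⟨n, hn⟩ := exists_nat_gt (M / δ)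
  have hM : 0 ≤ M := (norm_nonneg _).trans (h 0 (by simpa using hε.le))
  have hn0 : (0 : ℝ) < n := lt_of_le_of_lt (by positivity) hn
  refine ⟨ε / n, by positivity, fun {a} ha => ?_⟩
  rw [dist_zero_right] at ha ⊢
  have h1 := h (n * a) (by
    rw [norm_mul, Complex.norm_natCast]
    rw [lt_div_iff₀ hn0] at ha
    linarith)
  rw [map_mul, map_natCast, norm_mul, Complex.norm_natCast] at h1
  rw [div_lt_iff₀ hδ] at hn
  by_contra! h2
  nlinarith

/-- On an infinite-dimensional space, an automorphism of `ℂ` which is separately dominated along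
the pairing of the space with its dual is continuous. -/
theorem continuous_of_norm_apply_le (hinf : ¬ FiniteDimensional ℂ X) {τ : ℂ ≃+* ℂ} {N : X → ℝ}
    {M : StrongDual ℂ X → ℝ} (hN : ∀ x, 0 ≤ N x) (h : ∀ x f, ‖τ (f x)‖ ≤ N x * M f) :
    Continuous τ := by
  by_contra hτ
  obtain ⟨x, f, hxf⟩ := exists_biorthogonal_sequence hinf
  -- A discontinuous `τ` is unbounded near zero. The sum `g` of the `a n • f n` then satisfies `g (x
  -- n) = a n`, so `n * N (x n) < N (x n) * M g` for every `n`, which fails once `n ≥ M g`.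
  have hsmall : ∀ n : ℕ, ∃ a : ℂ, ‖a • f n‖ ≤ (1 / 2) ^ n ∧ n * N (x n) < ‖τ a‖ := by
    intro n
    by_contra! h1
    refine hτ (continuous_of_bounded_near_zero (ε := (1 / 2) ^ n / (‖f n‖ + 1))
      (M := n * N (x n)) (by positivity) fun a ha => h1 a ?_)
    rw [le_div_iff₀ (by positivity)] at ha
    rw [norm_smul]
    nlinarith [norm_nonneg a]
  choose a ha1 ha2 using hsmall
  have hsum : Summable fun n => a n • f n :=
    Summable.of_norm_bounded summable_geometric_two ha1
  obtain ⟨g, hg⟩ := hsum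
  have hgx : ∀ m, g (x m) = a m := by
    intro m
    have h1 : HasSum (fun n => (a n • f n) (x m)) (g (x m)) :=
      hg.mapL (ContinuousLinearMap.apply ℂ ℂ (x m))
    refine h1.unique ?_
    have h2 := hasSum_single (f := fun n => (a n • f n) (x m)) m (fun n hn => by simp [hxf, hn])
    simpa [hxf] using h2
  obtain ⟨n, hn⟩ := exists_nat_ge (M g)
  have h1 := h (x n) g
  rw [hgx] at h1
  have h2 := ha2 n
  nlinarith [mul_le_mul_of_nonneg_left hn (hN (x n))]

variable {V : Type*} [NormedAddCommGroup V] [NormedSpace ℂ V] [CompleteSpace V] [CompleteSpace X]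

/-- Closed graph theorem over `ℝ`: each `g i ∘ A = τ ∘ e i` is continuous, and the `e i` separate
points, so limits in the graph are forced. -/
theorem continuous_of_intertwines_separating {τ : ℂ ≃+* ℂ} (hτ : Continuous τ) {A : V ≃+ X}
    (hA : ∀ (r : ℝ) v, A (r • v) = r • A v) {ι : Type*} {e : ι → StrongDual ℂ V}
    {g : ι → StrongDual ℂ X} (he : ∀ v, (∀ i, e i v = 0) → v = 0)
    (hg : ∀ i v, g i (A v) = τ (e i v)) : Continuous A := by
  let L : V →ₗ[ℝ] X := { toFun := A, map_add' := map_add A, map_smul' := hA }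
  refine L.continuous_of_seq_closed_graph fun u x y hu huy => ?_
  obtain ⟨z, rfl⟩ := A.surjective y
  change A z = A x
  congr 1
  rw [← sub_eq_zero]
  refine he _ fun i => ?_
  rw [map_sub, sub_eq_zero]
  apply τ.injective
  have h1 : Tendsto (fun n => τ (e i (u n))) atTop (𝓝 (τ (e i x))) :=
    ((hτ.comp (e i).continuous).tendsto x).comp hu
  have h2 : Tendsto (fun n => g i (A (u n))) atTop (𝓝 (g i (A z))) :=
    ((g i).continuous.tendsto _).comp huy
  simp only [hg] at h2
  exact tendsto_nhds_unique h2 h1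

theorem exists_continuousLinearEquiv_of_intertwines {τ : ℂ ≃+* ℂ} (hτ : Continuous τ) {A : V ≃+ X}
    (hA : ∀ (c : ℂ) v, A (c • v) = τ c • A v) {ι : Type*} {e : ι → StrongDual ℂ V}
    {g : ι → StrongDual ℂ X} (he : ∀ v, (∀ i, e i v = 0) → v = 0)
    (hg : ∀ i v, g i (A v) = τ (e i v)) :
    (∃ A' : V ≃L[ℂ] X, ∀ v, A' v = A v) ∨ (∃ A' : V ≃L⋆[ℂ] X, ∀ v, A' v = A v) := by
  rcases Complex.ringHom_eq_id_or_conj_of_continuous (f := (τ : ℂ →+* ℂ)) hτ with h | h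
  · have hτc : ∀ c, τ c = c := fun c => RingHom.congr_fun h c
    simp only [hτc] at hA
    have hcont := continuous_of_intertwines_separating hτ (A := A)
      (fun r v => by rw [← Complex.coe_smul, hA, Complex.coe_smul]) he hg
    let L : V ≃ₗ[ℂ] X := { A with map_smul' := hA }
    exact Or.inl ⟨L.toContinuousLinearEquivOfContinuous hcont, fun v => rfl⟩
  · have hτc : ∀ c, τ c = starRingEnd ℂ c := fun c => RingHom.congr_fun h c
    simp only [hτc] at hA
    have hcont := continuous_of_intertwines_separating hτ (A := A)
      (fun r v => by rw [← Complex.coe_smul, hA, Complex.conj_ofReal, Complex.coe_smul]) he hg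
    let L : V ≃ₛₗ[starRingEnd ℂ] X := { A with map_smul' := hA }
    exact Or.inr ⟨L.toContinuousLinearEquivOfContinuous hcont, fun v => rfl⟩

end BoundedSemilinear

/-! ### Matrices of semilinear bijections. -/

section SemilinearMatrix

theorem exists_generalLinearGroup_of_semilinear {K V X : Type*} [Field K] [AddCommGroup V]
    [Module K V] [AddCommGroup X] [Module K X] {n : ℕ} (b : Module.Basis (Fin n) K X)
    (b' : Module.Basis (Fin n) K V) {τ : K ≃+* K} {A : V ≃+ X}
    (hA : ∀ (c : K) v, A (c • v) = τ c • A v) :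
    ∃ M : Matrix.GeneralLinearGroup (Fin n) K, ∀ (P : X →ₗ[K] X) (S : V →ₗ[K] V) (c : K),
      (∀ v, P (A v) = c • A (S v)) →
      LinearMap.toMatrix b b P = c • ((M : Matrix (Fin n) (Fin n) K) *
        (LinearMap.toMatrix b' b' S).map τ *
        ((M⁻¹ : Matrix.GeneralLinearGroup (Fin n) K) : Matrix (Fin n) (Fin n) K)) := by
  let M : Matrix (Fin n) (Fin n) K := Matrix.of fun i j => b.repr (A (b' j)) i
  have hM : IsUnit M := by
    rw [← Matrix.mulVec_injective_iff_isUnit]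
    refine (injective_iff_map_eq_zero (Matrix.mulVecLin M)).2 fun c hc => ?_
    -- The columns of `M` are the coordinates of the `A (b' j)`. Untwisting the coefficients by
    -- `τ.symm` turns `M c = 0` into a statement about `A`.
    have h1 : A (∑ j, τ.symm (c j) • b' j) = 0 := by
      apply b.repr.injective
      ext i
      have h2 := congrFun hc i
      simp only [Matrix.mulVecLin_apply, Matrix.mulVec, dotProduct, M, Matrix.of_apply] at h2
      simp only [map_sum, hA, RingEquiv.apply_symm_apply, map_smul, Finsupp.coe_finsetSum,
        Finset.sum_apply, Finsupp.smul_apply, smul_eq_mul, map_zero, Finsupp.coe_zero]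
      rw [← h2]
      exact Finset.sum_congr rfl fun j _ => mul_comm _ _
    rw [map_eq_zero_iff A A.injective] at h1
    ext j
    have h3 := Fintype.linearIndependent_iff.1 b'.linearIndependent _ h1 j
    simpa using h3
  refine ⟨hM.unit, fun P S c hPS => ?_⟩
  have key : LinearMap.toMatrix b b P * M = c • (M * (LinearMap.toMatrix b' b' S).map τ) := by
    ext i j
    have h1 : (LinearMap.toMatrix b b P * M) i j = b.repr (P (A (b' j))) i := by
      rw [← LinearMap.toMatrix_mulVec_repr b b P (A (b' j))]
      rfl
    have h2 : A (S (b' j)) = ∑ k, τ (b'.repr (S (b' j)) k) • A (b' k) := by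
      conv_lhs => rw [← b'.sum_repr (S (b' j))]
      simp only [map_sum, hA]
    rw [h1, hPS, h2]
    simp only [map_smul, map_sum, Finsupp.smul_apply, Finsupp.coe_finsetSum, Finset.sum_apply,
      smul_eq_mul, Matrix.smul_apply, Matrix.mul_apply, Matrix.map_apply,
      LinearMap.toMatrix_apply, M, Matrix.of_apply]
    congr 1
    exact Finset.sum_congr rfl fun k _ => mul_comm _ _
  have h1 : M * ((hM.unit⁻¹ : Matrix.GeneralLinearGroup (Fin n) K) : Matrix (Fin n) (Fin n) K) = 1 :=
    hM.mul_val_inv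
  calc LinearMap.toMatrix b b P = LinearMap.toMatrix b b P * (M * _) := by rw [h1, mul_one]
    _ = _ := by rw [← mul_assoc, key, Matrix.smul_mul]; rfl

theorem exists_basis_toMatrix_dualOperator {X : Type*} [NormedAddCommGroup X] [NormedSpace ℂ X]
    {n : ℕ} (b : Module.Basis (Fin n) ℂ X) :
    ∃ b' : Module.Basis (Fin n) ℂ (StrongDual ℂ X), ∀ T : X →L[ℂ] X,
      LinearMap.toMatrix b' b' (dualOperator T : StrongDual ℂ X →ₗ[ℂ] StrongDual ℂ X) =
        (LinearMap.toMatrix b b (T : X →ₗ[ℂ] X)).transpose := by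
  have : FiniteDimensional ℂ X := b.finiteDimensional_of_finite
  refine ⟨b.dualBasis.map LinearMap.toContinuousLinearMap, fun T => ?_⟩
  rw [← LinearMap.toMatrix_transpose]
  ext i j
  rw [LinearMap.toMatrix_apply, LinearMap.toMatrix_apply]
  rfl

end SemilinearMatrix

/-! ### The main theorem. -/

theorem mainTheorem2 {X : Type*} [NormedAddCommGroup X] [NormedSpace ℂ X] [CompleteSpace X]
    (hdim : 3 ≤ Module.rank ℂ X)
    (ψ : rankOneNilpotentsWithZero X → rankOneNilpotentsWithZero X)
    (hsurj : Function.Surjective ψ)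
    (hzero : ψ ⟨0, Or.inr rfl⟩ = ⟨0, Or.inr rfl⟩)
    (hdep : ∀ T S : rankOneNilpotentsWithZero X,
      LinDepPair (T : X →L[ℂ] X) (S : X →L[ℂ] X) ↔
        LinDepPair (ψ T : X →L[ℂ] X) (ψ S : X →L[ℂ] X))
    (hsim : ∀ T S : rankOneNilpotents X,
      SameRangeOrKer (T : X →L[ℂ] X) (S : X →L[ℂ] X) ↔
        SameRangeOrKer (ψ ⟨T, Or.inl T.2⟩ : X →L[ℂ] X) (ψ ⟨S, Or.inl S.2⟩ : X →L[ℂ] X)) :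
    (¬ FiniteDimensional ℂ X →
      ∃ c : rankOneNilpotents X → ℂˣ,
        -- `ψ T = c T • A T A⁻¹` with `A : X → X` linear or conjugate-linear
        (∃ A : X ≃L[ℂ] X, ∀ (T : rankOneNilpotents X) (x : X),
          (ψ ⟨T, Or.inl T.2⟩ : X →L[ℂ] X) x =
            (c T : ℂ) • A ((T : X →L[ℂ] X) (A.symm x))) ∨
        (∃ A : X ≃L⋆[ℂ] X, ∀ (T : rankOneNilpotents X) (x : X),
          (ψ ⟨T, Or.inl T.2⟩ : X →L[ℂ] X) x =
            (c T : ℂ) • A ((T : X →L[ℂ] X) (A.symm x))) ∨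
        -- `ψ T = c T • A T' A⁻¹` with `A : X* → X` linear or conjugate-linear
        (∃ A : StrongDual ℂ X ≃L[ℂ] X, ∀ (T : rankOneNilpotents X) (x : X),
          (ψ ⟨T, Or.inl T.2⟩ : X →L[ℂ] X) x =
            (c T : ℂ) • A (dualOperator (T : X →L[ℂ] X) (A.symm x))) ∨
        (∃ A : StrongDual ℂ X ≃L⋆[ℂ] X, ∀ (T : rankOneNilpotents X) (x : X),
          (ψ ⟨T, Or.inl T.2⟩ : X →L[ℂ] X) x =
            (c T : ℂ) • A (dualOperator (T : X →L[ℂ] X) (A.symm x)))) ∧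
    -- the finite-dimensional case, in the matrix form relative to an arbitrary basis
    (∀ (n : ℕ) (b : Module.Basis (Fin n) ℂ X),
      ∃ (c : rankOneNilpotents X → ℂˣ) (A : Matrix.GeneralLinearGroup (Fin n) ℂ) (τ : ℂ ≃+* ℂ),
        (∀ T : rankOneNilpotents X,
          LinearMap.toMatrix b b ((ψ ⟨T, Or.inl T.2⟩ : X →L[ℂ] X) : X →ₗ[ℂ] X) =
            (c T : ℂ) • ((A : Matrix (Fin n) (Fin n) ℂ) *
              (LinearMap.toMatrix b b ((T : X →L[ℂ] X) : X →ₗ[ℂ] X)).map τ *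
              ((A⁻¹ : Matrix.GeneralLinearGroup (Fin n) ℂ) : Matrix (Fin n) (Fin n) ℂ))) ∨
        (∀ T : rankOneNilpotents X,
          LinearMap.toMatrix b b ((ψ ⟨T, Or.inl T.2⟩ : X →L[ℂ] X) : X →ₗ[ℂ] X) =
            (c T : ℂ) • ((A : Matrix (Fin n) (Fin n) ℂ) *
              ((LinearMap.toMatrix b b ((T : X →L[ℂ] X) : X →ₗ[ℂ] X)).map τ).transpose *
              ((A⁻¹ : Matrix.GeneralLinearGroup (Fin n) ℂ) : Matrix (Fin n) (Fin n) ℂ)))) := by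
  have hmem : ∀ T : rankOneNilpotents X, (ψ ⟨T, Or.inl T.2⟩ : X →L[ℂ] X) ∈ rankOneNilpotents X := by
    intro T
    refine (ψ ⟨T, Or.inl T.2⟩).2.resolve_right fun h0 => ?_
    obtain ⟨x, f, hx, hf, hfx, hT⟩ := exists_smulRight_of_mem_rankOneNilpotents T.2
    -- If `ψ T` were zero, it would be dependent with everything, so `T` would be dependent with
    -- `f.smulRight y`, whose range differs.
    obtain ⟨y, hy, hfy⟩ := exists_linearIndependent_apply_eq_zero hdim hx hfx
    have hS := smulRight_mem_rankOneNilpotents hf (hy.ne_zero 1) hfy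
    have h1 := (hdep ⟨T, Or.inl T.2⟩ ⟨_, Or.inl hS⟩).2 fun h => h.ne_zero 0 h0
    rw [linDepPair_iff T.2 hS, hT, range_smulRight hf, range_smulRight hf] at h1
    obtain ⟨c, hc⟩ := exists_smul_eq_of_span_eq_span h1.1.symm
    exact (LinearIndependent.pair_iff' hx).1 hy c hc.symm
  obtain ⟨φ, hφψ⟩ : ∃ φ : rankOneNilpotents X → rankOneNilpotents X,
      ∀ T : rankOneNilpotents X, (ψ ⟨T, Or.inl T.2⟩ : X →L[ℂ] X) = φ T :=
    ⟨fun T => ⟨_, hmem T⟩, fun T => rfl⟩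
  have hφ : Function.Surjective φ := by
    intro S
    obtain ⟨⟨T, hT⟩, hTS⟩ := hsurj ⟨S, Or.inl S.2⟩
    rcases hT with hT | rfl
    · exact ⟨⟨T, hT⟩, Subtype.ext ((hφψ ⟨T, hT⟩).symm.trans (congrArg Subtype.val hTS))⟩
    · rw [hzero] at hTS
      exact absurd (congrArg Subtype.val hTS).symm (ne_zero_of_mem_rankOneNilpotents S.2)
  have hmain := exists_semilinear_of_preserves_linDepPair_sameRangeOrKer hdim hφ
    (fun T S => by
      rw [← hφψ, ← hφψ]
      exact hdep ⟨T, Or.inl T.2⟩ ⟨S, Or.inl S.2⟩)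
    (fun T S => by
      rw [← hφψ, ← hφψ]
      exact hsim T S)
  simp only [hφψ]
  clear hmem hφψ hdep hsim hzero hsurj
  refine ⟨fun hinf => ?_, fun n b => ?_⟩
  · rcases hmain with ⟨τ, A, hA, hAf, hAφ⟩ | ⟨τ, A, hA, hAf, hAφ⟩
    · choose g hg using hAf
      choose c hc using hAφ
      -- The domination is `‖τ (f x)‖ = ‖g f (A x)‖ ≤ ‖g f‖ * ‖A x‖`.
      have hτ : Continuous τ := continuous_of_norm_apply_le hinf (N := fun x => ‖A x‖)
        (M := fun f => ‖g f‖) (fun x => norm_nonneg _)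
        (fun x f => by rw [← hg, mul_comm]; exact (g f).le_opNorm _)
      refine ⟨c, ?_⟩
      rcases exists_continuousLinearEquiv_of_intertwines hτ hA (e := fun f => f) (g := g)
        (fun x hx => (SeparatingDual.eq_zero_iff_forall_dual_eq_zero (R := ℂ) x).2 hx) hg with
        ⟨A', hA'⟩ | ⟨A', hA'⟩
      · refine Or.inl ⟨A', fun T x => ?_⟩
        obtain ⟨z, rfl⟩ := A'.surjective x
        rw [A'.symm_apply_apply, hA', hA']
        exact hc T z
      · refine Or.inr (Or.inl ⟨A', fun T x => ?_⟩)
        obtain ⟨z, rfl⟩ := A'.surjective x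
        rw [A'.symm_apply_apply, hA', hA']
        exact hc T z
    · choose g hg using hAf
      choose c hc using hAφ
      have hτ : Continuous τ := continuous_of_norm_apply_le hinf (N := fun x => ‖g x‖)
        (M := fun f => ‖A f‖) (fun x => norm_nonneg _)
        (fun x f => by rw [← hg]; exact (g x).le_opNorm _)
      refine ⟨c, ?_⟩
      rcases exists_continuousLinearEquiv_of_intertwines hτ hA
        (e := fun x => ContinuousLinearMap.apply ℂ ℂ x) (g := g)
        (fun f hf => ContinuousLinearMap.ext hf) hg with ⟨A', hA'⟩ | ⟨A', hA'⟩
      · refine Or.inr (Or.inr (Or.inl ⟨A', fun T x => ?_⟩))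
        obtain ⟨z, rfl⟩ := A'.surjective x
        rw [A'.symm_apply_apply, hA', hA']
        exact hc T z
      · refine Or.inr (Or.inr (Or.inr ⟨A', fun T x => ?_⟩))
        obtain ⟨z, rfl⟩ := A'.surjective x
        rw [A'.symm_apply_apply, hA', hA']
        exact hc T z
  · rcases hmain with ⟨τ, A, hA, -, hAφ⟩ | ⟨τ, A, hA, -, hAφ⟩
    · choose c hc using hAφ
      obtain ⟨M, hM⟩ := exists_generalLinearGroup_of_semilinear b b hA
      exact ⟨c, M, τ, Or.inl fun T => hM _ _ _ (hc T)⟩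
    · choose c hc using hAφ
      obtain ⟨b', hb'⟩ := exists_basis_toMatrix_dualOperator b
      obtain ⟨M, hM⟩ := exists_generalLinearGroup_of_semilinear b b' hA
      refine ⟨c, M, τ, Or.inr fun T => ?_⟩
      have h1 := hM _ (dualOperator (T : X →L[ℂ] X) : StrongDual ℂ X →ₗ[ℂ] StrongDual ℂ X) _ (hc T)
      rw [hb', Matrix.transpose_map] at h1
      exact h1
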